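/- **Setting.** Let $(X,d)$ be a complete separable metric space with a locally finite Borel measure $m$ of full support. For $\mu,\nu\in\mathcal P(X)$ (Borel probability measures) let $W_2(\mu,\nu)\in[0,\infty]$ be the $L^2$-Wasserstein distance, $\mathcal P_2(X)\subset\mathcal P(X)$ the measures with finite second moment, and $\mathrm{Ent}_m(\mu)=\int\rho\log\rho\,dm\in[-\infty,+\infty)$ if $\mu=\rho m$ and $(\rho\log\rho)^+$ is $m$-integrable, $\mathrm{Ent}_m(\mu)=+\infty$ otherwise; $D(\mathrm{Ent}_m)=\{\mathrm{Ent}_m<+\infty\}$. $X$ satisfies $\mathrm{CD}(K,\infty)$ if any $\mu_0,\mu_1\in\mathcal P_2(X)\cap D(\mathrm{Ent}_m)$ are joined by a $W_2$-geodesic $(\mu_t)_{t\in[0,1]}$ in $\mathcal P_2(X)$ with $\mathrm{Ent}_m(\mu_t)\le(1-t)\mathrm{Ent}_m(\mu_0)+t\,\mathrm{Ent}_m(\mu_1)-\frac K2t(1-t)W_2(\mu_0,\mu_1)^2$ for all $t\in[0,1]$. A metric measure space $(Y,d_Y,m_Y)$ satisfies (VG) if $\int_Y e^{-C^2d_Y(y,\bar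 y)^2}\,dm_Y(y)<\infty$ for some $\bar y\in Y$ and $C>0$. A *metric foliation* $\mathcal F$ of $X$ is a partition of $X$ into closed sets (leaves) such that $d(L,L')=d(x,L')$ for all leaves $L,L'$ and all $x\in L$. Let $p:X\to X^*$ be the quotient map onto the set of leaves, $d^*(y,y')=d(p^{-1}(y),p^{-1}(y'))$ and $m^*=p_*m$. A *disintegration* of $m$ for $p$ is a measurable family $\{\mu_y\}_{y\in X^*}\subset\mathcal P(X)$ such that $\mu_y(X\setminus p^{-1}(y))=0$ for $m^*$-a.e. $y$ and $m=\int\mu_y\,dm^*(y)$. $\mathcal F$ is a *metric measure foliation* if $m^*$ is locally finite and, for the ($m^*$-a.e. unique) disintegration $\{\mu_y\}$ of $m$, there is a Borel set $\Omega\subset X^*$ with $m^*(X^*\setminus\Omega)=0$ and $W_2(\mu_y,\mu_{y'})=d^*(y,y')$ for all $y,y'\in\Omega$. The pullback of $\nu\in\mathcal P(X^*)$ is $p^*\nu=\int\mu_y\,d\nu(y)$. For a metric measure space $(Z,d,m)$ put $|D^-\mathrm{Ent}_m|(\mu)=\limsup_{W_2(\nu,\mu)\to0,\ \nu\ne\mu}\frac{(\mathrm{Ent}_m(\mu)-\mathrm{Ent}_m(\nu))^+}{W_2(\mu,\nu)}$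 (equal to $+\infty$ if $\mu\notin D(\mathrm{Ent}_m)$, and to $0$ if $\mu$ is isolated). An *EDE flow* of $\mathrm{Ent}_m$ starting from $\bar\mu$ is a curve $\mu:[0,\infty)\to\mathcal P(Z)\cap D(\mathrm{Ent}_m)$ with $\mu_0=\bar\mu$ which is locally absolutely continuous for $W_2$ (that is, $W_2(\mu_s,\mu_t)\le\int_s^tf(r)\,dr$ for all $s<t$, for some $f\in L^1_{loc}([0,\infty))$) and satisfies $$\mathrm{Ent}_m(\mu_s)=\mathrm{Ent}_m(\mu_t)+\frac12\int_s^t|\dot\mu|(r)^2\,dr+\frac12\int_s^t|D^-\mathrm{Ent}_m|(\mu_r)^2\,dr\qquad(0\le s<t),$$ where $|\dot\mu|$ is the metric derivative with respect to $W_2$. It is a *heat flow* ($W_2$-gradient flow of $\mathrm{Ent}_m$) if moreover $\mu_t\in\mathcal P_2(Z)$ for all $t\ge0$. **Proposition.** Let $X$ satisfy $\mathrm{CD}(K,\infty)$ for some $K\in\mathbb R$, let $\mathcal F$ be a metric measure foliation of $X$, and assume that $(X^*,d^*,m^*)$ satisfies (VG). Let $\{\mu_y\}$ be any disintegration of $m$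 for $p$, and let $\mu:[0,\infty)\to\mathcal P_2(X^*)\cap D(\mathrm{Ent}_{m^*})$ be a heat flow on $X^*$ starting from $\bar\mu$. Then $t\mapsto p^*\mu_t$ is an EDE flow of $\mathrm{Ent}_m$ on $X$ starting from $p^*\bar\mu$. If moreover $p^*\bar\mu\in\mathcal P_2(X)$, then $p^*\mu_t\in\mathcal P_2(X)$ for all $t\ge0$, so $t\mapsto p^*\mu_t$ is the heat flow on $X$ starting from $p^*\bar\mu$. -/

import Mathlib

open MeasureTheory ProbabilityTheory Filter Topology Set
open scoped NNReal ENNReal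

noncomputable section

/-! ### Optimal transport and relative entropy -/

section Transport

variable {X : Type*} [MetricSpace X] [MeasurableSpace X]

/-- Transport plans between two measures: measures on the product with the given marginals. -/
def couplings (μ ν : Measure X) : Set (Measure (X × X)) :=
  {π | π.map Prod.fst = μ ∧ π.map Prod.snd = ν}

/-- The `L²`-Wasserstein distance, with values in `[0, ∞]`. -/
def W2 (μ ν : Measure X) : ℝ≥0∞ :=
  (⨅ π ∈ couplings μ ν, ∫⁻ q, edist q.1 q.2 ^ 2 ∂π) ^ (1 / 2 : ℝ)

/-- Finiteness of the second moment; a probability measure with this property is an element of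
`P₂(X)`. -/
def FiniteSecondMoment (μ : Measure X) : Prop :=
  ∃ x₀ : X, ∫⁻ x, edist x x₀ ^ 2 ∂μ < ⊤

/-- The relative entropy `Ent_m(μ) ∈ [-∞, +∞]`. If `μ = ρ m`, it is `∫ ρ log ρ dm` when the
positive part of `ρ log ρ` is integrable, and `+∞` when it is not; it is `+∞` if `μ` is not
absolutely continuous. (`Real.negMulLog r = - r * log r`.) -/
def entropy (m μ : Measure X) : EReal :=
  open Classical in
  if μ ≪ m ∧
      ∫⁻ x, ENNReal.ofReal (-Real.negMulLog (μ.rnDeriv m x).toReal) ∂m ≠ ⊤ then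
    ((∫⁻ x, ENNReal.ofReal (-Real.negMulLog (μ.rnDeriv m x).toReal) ∂m : ℝ≥0∞) : EReal) -
      ((∫⁻ x, ENNReal.ofReal (Real.negMulLog (μ.rnDeriv m x).toReal) ∂m : ℝ≥0∞) : EReal)
  else ⊤

/-- The curvature-dimension condition `CD(K, ∞)`: any two measures of `P₂(X) ∩ D(Ent_m)` are joined
by a `W₂`-geodesic in `P₂(X)` along which the entropy is `K`-convex between the end points. -/
def CDInfinity (K : ℝ) (m : Measure X) : Prop :=
  ∀ μ₀ μ₁ : ProbabilityMeasure X,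
    FiniteSecondMoment (μ₀ : Measure X) → FiniteSecondMoment (μ₁ : Measure X) →
    entropy m μ₀ < ⊤ → entropy m μ₁ < ⊤ →
    ∃ μ : ℝ → ProbabilityMeasure X,
      μ 0 = μ₀ ∧ μ 1 = μ₁ ∧
      (∀ t ∈ Icc (0 : ℝ) 1, FiniteSecondMoment (μ t : Measure X)) ∧
      (∀ s ∈ Icc (0 : ℝ) 1, ∀ t ∈ Icc (0 : ℝ) 1,
        W2 (μ s : Measure X) (μ t) = ENNReal.ofReal |s - t| * W2 (μ₀ : Measure X) μ₁) ∧
      ∀ t ∈ Icc (0 : ℝ) 1,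
        entropy m (μ t) ≤
          ((1 - t : ℝ) : EReal) * entropy m μ₀ + ((t : ℝ) : EReal) * entropy m μ₁ -
            ((K / 2 * t * (1 - t) * (W2 (μ₀ : Measure X) μ₁).toReal ^ 2 : ℝ) : EReal)

/-- The volume growth condition (VG). -/
def VolumeGrowth (m : Measure X) : Prop :=
  ∃ (x₀ : X) (C : ℝ), 0 < C ∧
    ∫⁻ x, ENNReal.ofReal (Real.exp (-(C ^ 2 * dist x x₀ ^ 2))) ∂m < ⊤

/-! ### Gradient flows of the entropy -/

/-- The descending slope of the entropy:
`limsup_{W₂(ν, μ) → 0, ν ≠ μ} (Ent_m(μ) - Ent_m(ν))⁺ / W₂(μ, ν)`, which is `+∞` outside `D(Ent_m)`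
(and `0` at isolated measures). For `μ ∈ P₂(X)`, every `ν` at finite distance is in `P₂(X)`. -/
def entropySlope (m : Measure X) (μ : ProbabilityMeasure X) : ℝ≥0∞ :=
  open Classical in
  if entropy m μ = ⊤ then ⊤
  else ⨅ (δ : ℝ≥0∞) (_ : 0 < δ), ⨆ (ν : ProbabilityMeasure X) (_ : ν ≠ μ)
    (_ : W2 (ν : Measure X) μ < δ),
      (entropy m μ - entropy m ν).toENNReal / W2 (μ : Measure X) ν

/-- Local absolute continuity with respect to `W₂` of a curve of probability measures defined on
`[0, ∞)`: there is `f ∈ L¹_loc([0, ∞))` with `W₂(μ_s, μ_t) ≤ ∫_s^t f(r) dr` for `s < t`. -/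
def IsLocallyACCurve (μ : ℝ≥0 → ProbabilityMeasure X) : Prop :=
  ∃ f : ℝ → ℝ, LocallyIntegrableOn f (Ici 0) ∧
    ∀ s t : ℝ≥0, s < t →
      W2 (μ s : Measure X) (μ t) ≤ ENNReal.ofReal (∫ r in (s : ℝ)..t, f r)

/-- The metric derivative `|μ̇|(r) = lim_{s → r} W₂(μ_s, μ_r) / |s - r|` with respect to `W₂`.
The limit exists for almost every `r` if `μ` is locally absolutely continuous; the definition uses
the limsup. -/
def metricDerivW2 (μ : ℝ≥0 → ProbabilityMeasure X) (r : ℝ≥0) : ℝ≥0∞ :=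
  limsup (fun s : ℝ≥0 => W2 (μ s : Measure X) (μ r) / edist s r) (𝓝[≠] r)

/-- `μ` is a gradient flow of `Ent_m`, in the sense of the Energy Dissipation Equation, in the
extended metric space `(P(X), W₂)`, starting from `μ₀`. -/
structure IsEDEFlow (m : Measure X) (μ₀ : ProbabilityMeasure X)
    (μ : ℝ≥0 → ProbabilityMeasure X) : Prop where
  initial : μ 0 = μ₀
  entropy_lt_top : ∀ t, entropy m (μ t) < ⊤
  locallyAC : IsLocallyACCurve μ
  ede : ∀ s t : ℝ≥0, s < t →
    entropy m (μ s) = entropy m (μ t) +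
      (((1 / 2) * (∫⁻ r in Ioc (s : ℝ) t, metricDerivW2 μ r.toNNReal ^ 2) +
        (1 / 2) * (∫⁻ r in Ioc (s : ℝ) t, entropySlope m (μ r.toNNReal) ^ 2) : ℝ≥0∞) : EReal)

/-- `μ` is a heat flow, i.e. a `W₂`-gradient flow of `Ent_m` in `P₂(X)` (in the EDE sense), starting
from `μ₀`. -/
structure IsHeatFlow (m : Measure X) (μ₀ : ProbabilityMeasure X)
    (μ : ℝ≥0 → ProbabilityMeasure X) : Prop extends IsEDEFlow m μ₀ μ where
  finiteSecondMoment : ∀ t, FiniteSecondMoment (μ t : Measure X)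

end Transport

/-! ### Metric foliations and their quotients -/

/-- The distance `inf {d(a, b) | a ∈ A, b ∈ B}` of two sets. -/
def setEDist {X : Type*} [MetricSpace X] (A B : Set X) : ℝ≥0∞ :=
  ⨅ a ∈ A, Metric.infEDist a B

/-- A metric foliation: a partition of `X` into closed leaves such that `d(L, L') = d(x, L')` for
all leaves `L, L'` and all `x ∈ L`. -/
structure MetricFoliation (X : Type*) [MetricSpace X] where
  leaves : Set (Set X)
  isPartition : Setoid.IsPartition leaves
  isClosed : ∀ L ∈ leaves, IsClosed L
  equidistant : ∀ L ∈ leaves, ∀ L' ∈ leaves, ∀ x ∈ L, setEDist L L' = Metric.infEDist x L'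

namespace MetricFoliation

variable {X : Type*} [MetricSpace X] (F : MetricFoliation X)

/-- Two points are equivalent if they lie in the same leaf. -/
def setoid : Setoid X := Setoid.mkClasses F.leaves F.isPartition.2

/-- The quotient space `X^*`. -/
def LeafSpace : Type _ := Quotient F.setoid

/-- The quotient map `p : X → X^*`. -/
def proj (x : X) : F.LeafSpace := Quotient.mk F.setoid x

theorem proj_surjective : Function.Surjective F.proj := Quotient.mk_surjective

theorem fiber_mem_leaves (y : F.LeafSpace) : F.proj ⁻¹' {y} ∈ F.leaves := by
  obtain ⟨x, rfl⟩ := F.proj_surjective y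
  have h : F.proj ⁻¹' {F.proj x} = {z | F.setoid z x} := by
    ext z
    exact Quotient.eq
  rw [h, ← Setoid.classes_mkClasses F.leaves F.isPartition]
  exact Setoid.mem_classes F.setoid x

theorem setEDist_fiber (x : X) (y : F.LeafSpace) :
    setEDist (F.proj ⁻¹' {F.proj x}) (F.proj ⁻¹' {y}) = Metric.infEDist x (F.proj ⁻¹' {y}) :=
  F.equidistant _ (F.fiber_mem_leaves _) _ (F.fiber_mem_leaves _) x rfl

/-- The quotient distance `d^*(y, y') = d(p⁻¹(y), p⁻¹(y'))`. -/
instance : EDist F.LeafSpace :=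
  ⟨fun y y' => setEDist (F.proj ⁻¹' {y}) (F.proj ⁻¹' {y'})⟩

theorem edist_def (y y' : F.LeafSpace) :
    edist y y' = setEDist (F.proj ⁻¹' {y}) (F.proj ⁻¹' {y'}) := rfl

theorem edist_proj_left (x : X) (y : F.LeafSpace) :
    edist (F.proj x) y = Metric.infEDist x (F.proj ⁻¹' {y}) := F.setEDist_fiber x y

instance : EMetricSpace F.LeafSpace where
  edist_self y := by
    obtain ⟨x, rfl⟩ := F.proj_surjective y
    rw [edist_proj_left]
    exact Metric.infEDist_zero_of_mem rfl
  edist_comm y y' := by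
    simp only [edist_def, setEDist, Metric.infEDist]
    rw [iInf₂_comm]
    simp only [edist_comm]
  edist_triangle y z w := by
    obtain ⟨x, rfl⟩ := F.proj_surjective y
    rw [edist_proj_left, edist_proj_left]
    conv_rhs => rw [Metric.infEDist, ENNReal.iInf_add]
    refine le_iInf fun a => ?_
    rw [ENNReal.iInf_add]
    refine le_iInf fun ha => ?_
    have hz : F.proj a = z := ha
    rw [← hz, edist_proj_left, add_comm]
    exact Metric.infEDist_le_infEDist_add_edist
  eq_of_edist_eq_zero {y y'} h := by
    obtain ⟨x, rfl⟩ := F.proj_surjective y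
    rw [edist_proj_left] at h
    exact (Metric.mem_iff_infEDist_zero_of_closed
      (F.isClosed _ (F.fiber_mem_leaves y'))).2 h

theorem edist_ne_top' (y y' : F.LeafSpace) : edist y y' ≠ ⊤ := by
  obtain ⟨x, rfl⟩ := F.proj_surjective y
  obtain ⟨x', rfl⟩ := F.proj_surjective y'
  rw [edist_proj_left]
  exact ne_top_of_le_ne_top (edist_ne_top x x') (Metric.infEDist_le_edist_of_mem rfl)

instance : MetricSpace F.LeafSpace := EMetricSpace.toMetricSpace F.edist_ne_top'

instance : MeasurableSpace F.LeafSpace := borel _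

instance : BorelSpace F.LeafSpace := ⟨rfl⟩

end MetricFoliation

/-! ### Metric measure foliations and pullbacks of measures -/

/-- The Markov kernel `κ` is a disintegration `{μ_y}` of `m` for `p`: the `μ_y` are probability measures depending
measurably on `y`, `μ_y` is concentrated on `p⁻¹(y)` for `p_* m`-almost every `y`, and
`m = ∫ μ_y d(p_* m)(y)`. -/
structure IsDisintegration {X Y : Type*} [MeasurableSpace X] [MeasurableSpace Y]
    (p : X → Y) (m : Measure X) (κ : Kernel Y X) [IsMarkovKernel κ] : Prop where
  fiber : ∀ᵐ y ∂(m.map p), κ y (p ⁻¹' {y})ᶜ = 0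
  bind_eq : (m.map p).bind κ = m

/-- A metric foliation is a metric measure foliation if `p_* m` is locally finite and the
disintegration `{μ_y}` of `m` for `p` satisfies `W₂(μ_y, μ_{y'}) = d^*(y, y')` for all `y, y'` in a
Borel set of full measure. -/
def MetricFoliation.IsMetricMeasureFoliation {X : Type*} [MetricSpace X] [MeasurableSpace X]
    (F : MetricFoliation X) (m : Measure X) : Prop :=
  IsLocallyFiniteMeasure (m.map F.proj) ∧
    ∃ (κ : Kernel F.LeafSpace X) (_ : IsMarkovKernel κ), IsDisintegration F.proj m κ ∧
      ∃ Ω : Set F.LeafSpace, MeasurableSet Ω ∧ m.map F.proj Ωᶜ = 0 ∧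
        ∀ y ∈ Ω, ∀ y' ∈ Ω, W2 (κ y) (κ y') = edist y y'

/-- The pullback measure `p^* ν = ∫ μ_y dν(y)` of a probability measure, where `κ = {μ_y}`. -/
def pullbackMeasure {X Y : Type*} [MeasurableSpace X] [MeasurableSpace Y]
    (κ : Kernel Y X) [IsMarkovKernel κ] (ν : ProbabilityMeasure Y) : ProbabilityMeasure X :=
  ⟨(ν : Measure Y).bind κ, inferInstance⟩

end

/-! On absolutely continuous measures, pulling back along `p` preserves everything that enters the
energy dissipation equation, so the equation transfers term by term.

Distance (`W2_pullbackMeasure`): since `p` is 1-Lipschitz and `p_* p^* ν = ν`, pulling back cannot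
shrink `W2`. Conversely, averaging plans between `μ_y` and `μ_{y'}` over a plan for the base
measures gives a plan upstairs of no larger cost (`W2_bind_le`). Measurable selection of fibre plans
is avoided: `y` is rounded to a countable set, and the limit is taken by tightness and lower
semicontinuity of the cost.

Entropy (`entropy_bind`): if `ν` has density `ρ`, then `p^* ν` has density `ρ ∘ p`.

Slope (`entropySlope_pullbackMeasure`): competitors on the quotient pull back to competitors on `X`
with the same quotient. Conversely, projecting a competitor on `X` lowers its entropy, by Jensen on
the fibres (`entropy_map_le`), and brings it no farther, so the difference quotient does not
decrease.

Second moments propagate because the flow stays at finite `W2` distance from its starting point. -/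

theorem ENNReal.add_sq_le (a b : ℝ≥0∞) : (a + b) ^ 2 ≤ 2 * a ^ 2 + 2 * b ^ 2 := by
  rcases eq_or_ne a ⊤ with rfl | ha
  · simp [ENNReal.mul_top]
  rcases eq_or_ne b ⊤ with rfl | hb
  · simp [ENNReal.mul_top]
  lift a to ℝ≥0 using ha
  lift b to ℝ≥0 using hb
  rw [← mul_add]
  have h : (a + b) ^ 2 ≤ 2 * (a ^ 2 + b ^ 2) := by
    rw [← NNReal.coe_le_coe]
    push_cast
    exact _root_.add_sq_le
  exact_mod_cast h

/-! ### The Wasserstein distance -/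

section Wasserstein

variable {X Y : Type*} [MetricSpace X] [MeasurableSpace X] [MetricSpace Y] [MeasurableSpace Y]

theorem W2_le_of_mem_couplings {μ ν : Measure X} {π : Measure (X × X)} (hπ : π ∈ couplings μ ν) :
    W2 μ ν ≤ (∫⁻ q, edist q.1 q.2 ^ 2 ∂π) ^ (1 / 2 : ℝ) :=
  ENNReal.rpow_le_rpow (iInf₂_le π hπ) (by norm_num)

theorem exists_coupling_lt {μ ν : Measure X} {c : ℝ≥0∞} (h : W2 μ ν ^ 2 < c) :
    ∃ π ∈ couplings μ ν, ∫⁻ q, edist q.1 q.2 ^ 2 ∂π < c := by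
  have h' : W2 μ ν ^ 2 = ⨅ π ∈ couplings μ ν, ∫⁻ q, edist q.1 q.2 ^ 2 ∂π := by
    rw [W2, ← ENNReal.rpow_natCast, ← ENNReal.rpow_mul]
    norm_num
  rw [h'] at h
  simpa [iInf_lt_iff] using h

theorem W2_le_of_forall_couplings {μ ν : Measure X} {c : ℝ≥0∞}
    (h : ∀ π ∈ couplings μ ν, c ^ 2 ≤ ∫⁻ q, edist q.1 q.2 ^ 2 ∂π) : c ≤ W2 μ ν := by
  by_contra! hlt
  obtain ⟨π, hπ, hc⟩ := exists_coupling_lt (ENNReal.pow_lt_pow_left two_ne_zero hlt)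
  exact (h π hπ).not_gt hc

theorem isProbabilityMeasure_of_mem_couplings {X : Type*} [MeasurableSpace X]
    {μ ν : Measure X} [IsProbabilityMeasure μ]
    {π : Measure (X × X)} (hπ : π ∈ couplings μ ν) : IsProbabilityMeasure π := by
  refine ⟨?_⟩
  rw [← measure_univ (μ := μ), ← hπ.1, Measure.map_apply measurable_fst MeasurableSet.univ,
    preimage_univ]

/-- Pushing forward under a `1`-Lipschitz map does not increase the Wasserstein distance. -/
theorem W2_map_le {f : X → Y} (hf : Measurable f) (hL : LipschitzWith 1 f) (μ ν : Measure X) :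
    W2 (μ.map f) (ν.map f) ≤ W2 μ ν := by
  refine W2_le_of_forall_couplings fun π hπ => ?_
  have hm : Measurable (Prod.map f f) := hf.prodMap hf
  have hmem : π.map (Prod.map f f) ∈ couplings (μ.map f) (ν.map f) := by
    constructor
    · rw [Measure.map_map measurable_fst hm, ← hπ.1, Measure.map_map hf measurable_fst]
      rfl
    · rw [Measure.map_map measurable_snd hm, ← hπ.2, Measure.map_map hf measurable_snd]
      rfl
  calc W2 (μ.map f) (ν.map f) ^ 2
      ≤ ((∫⁻ q, edist q.1 q.2 ^ 2 ∂(π.map (Prod.map f f))) ^ (1 / 2 : ℝ)) ^ 2 := by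
        gcongr
        exact W2_le_of_mem_couplings hmem
    _ = ∫⁻ q, edist q.1 q.2 ^ 2 ∂(π.map (Prod.map f f)) := by
        rw [← ENNReal.rpow_natCast, ← ENNReal.rpow_mul]
        norm_num
    _ ≤ ∫⁻ q, edist (f q.1) (f q.2) ^ 2 ∂π := lintegral_map_le _ _
    _ ≤ ∫⁻ q, edist q.1 q.2 ^ 2 ∂π := by
        gcongr with q
        simpa using hL q.1 q.2

variable [SecondCountableTopology X] [BorelSpace X]

/-- Integrate `f q.1 - f q.2` against any plan and use Cauchy–Schwarz: the `L¹` cost is at most the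
root of the `L²` cost. The oscillation bound only serves to make `f` integrable. -/
theorem edist_integral_le_W2 (μ ν : Measure X) [IsProbabilityMeasure μ] [IsProbabilityMeasure ν]
    {f : X → ℝ} {C : ℝ} (hC : ∀ x y, dist (f x) (f y) ≤ C) {L : ℝ≥0} (hL : LipschitzWith L f) :
    edist (∫ x, f x ∂μ) (∫ x, f x ∂ν) ≤ L * W2 μ ν := by
  have hint : ∀ ρ : Measure X, [IsProbabilityMeasure ρ] → Integrable f ρ := by
    intro ρ _
    obtain ⟨x₀⟩ := nonempty_of_isProbabilityMeasure ρ
    refine Integrable.of_bound hL.continuous.aestronglyMeasurable (C + ‖f x₀‖) (ae_of_all _ ?_)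
    intro x
    have h1 := hC x x₀
    rw [dist_eq_norm] at h1
    linarith [norm_sub_norm_le (f x) (f x₀)]
  rcases eq_or_ne L 0 with rfl | hL0
  · obtain ⟨x₀⟩ := nonempty_of_isProbabilityMeasure μ
    have hc : f = fun _ => f x₀ := by
      funext x
      simpa using hL x x₀
    rw [hc]
    simp
  rw [mul_comm, ← ENNReal.div_le_iff_le_mul (Or.inl (by simpa using hL0))
    (Or.inl ENNReal.coe_ne_top)]
  refine W2_le_of_forall_couplings fun π hπ => ?_
  have := isProbabilityMeasure_of_mem_couplings hπ
  have hf := hL.continuous.measurable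
  have h1 : edist (∫ x, f x ∂μ) (∫ x, f x ∂ν) ≤ ∫⁻ q, edist (f q.1) (f q.2) ∂π := by
    have i1 : Integrable (fun q : X × X => f q.1) π := by
      have := hint μ
      rw [← hπ.1] at this
      exact this.comp_measurable measurable_fst
    have i2 : Integrable (fun q : X × X => f q.2) π := by
      have := hint ν
      rw [← hπ.2] at this
      exact this.comp_measurable measurable_snd
    have e1 : ∫ x, f x ∂μ = ∫ q, f q.1 ∂π := by
      rw [← hπ.1, integral_map measurable_fst.aemeasurable hf.aestronglyMeasurable]
    have e2 : ∫ x, f x ∂ν = ∫ q, f q.2 ∂π := by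
      rw [← hπ.2, integral_map measurable_snd.aemeasurable hf.aestronglyMeasurable]
    rw [e1, e2, edist_eq_enorm_sub, ← integral_sub i1 i2]
    simp_rw [edist_eq_enorm_sub]
    exact enorm_integral_le_lintegral_enorm _
  have h2 : ∫⁻ q, edist (f q.1) (f q.2) ∂π ≤ L * ∫⁻ q, edist q.1 q.2 ∂π := by
    rw [← lintegral_const_mul' _ _ ENNReal.coe_ne_top]
    exact lintegral_mono fun q => hL q.1 q.2
  have h3 : (∫⁻ q, edist q.1 q.2 ∂π) ^ 2 ≤ ∫⁻ q, edist q.1 q.2 ^ 2 ∂π := by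
    have h := ENNReal.lintegral_mul_le_Lp_mul_Lq π Real.HolderConjugate.two_two
      (f := fun q : X × X => edist q.1 q.2) (g := fun _ => 1)
      measurable_edist.aemeasurable aemeasurable_const
    have h' : ∫⁻ q, edist q.1 q.2 ∂π ≤ (∫⁻ q, edist q.1 q.2 ^ 2 ∂π) ^ (1 / 2 : ℝ) := by
      simpa using h
    calc (∫⁻ q, edist q.1 q.2 ∂π) ^ 2
        ≤ ((∫⁻ q, edist q.1 q.2 ^ 2 ∂π) ^ (1 / 2 : ℝ)) ^ 2 := by gcongr
      _ = _ := by
        rw [← ENNReal.rpow_natCast, ← ENNReal.rpow_mul]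
        norm_num
  refine le_trans ?_ h3
  gcongr
  refine ENNReal.div_le_of_le_mul ?_
  rw [mul_comm]
  exact h1.trans h2

theorem tendsto_of_tendsto_W2 {μs : ℕ → ProbabilityMeasure X} {μ : ProbabilityMeasure X}
    (h : Tendsto (fun n => W2 (μs n : Measure X) μ) atTop (𝓝 0)) : Tendsto μs atTop (𝓝 μ) := by
  rw [tendsto_iff_forall_lipschitz_integral_tendsto]
  rintro f ⟨C, hC⟩ ⟨L, hL⟩
  rw [tendsto_iff_edist_tendsto_0]
  have h0 : Tendsto (fun n => L * W2 (μs n : Measure X) μ) atTop (𝓝 0) := by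
    simpa using ENNReal.Tendsto.const_mul h (Or.inr (ENNReal.coe_ne_top (r := L)))
  exact tendsto_of_tendsto_of_tendsto_of_le_of_le tendsto_const_nhds h0 (fun _ => zero_le)
    fun n => edist_integral_le_W2 _ _ hC hL

theorem finiteSecondMoment_of_W2_ne_top {μ ν : Measure X} (h : W2 μ ν ≠ ⊤)
    (hμ : FiniteSecondMoment μ) [IsProbabilityMeasure μ] : FiniteSecondMoment ν := by
  obtain ⟨x₀, hx₀⟩ := hμ
  obtain ⟨π, hπ, hlt⟩ := exists_coupling_lt (ENNReal.pow_lt_top h.lt_top (n := 2))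
  have := isProbabilityMeasure_of_mem_couplings hπ
  have hm : Measurable fun x : X => edist x x₀ ^ 2 :=
    (measurable_id.edist measurable_const).pow_const 2
  refine ⟨x₀, ?_⟩
  rw [← hπ.1, lintegral_map hm measurable_fst] at hx₀
  rw [← hπ.2, lintegral_map hm measurable_snd]
  calc ∫⁻ q, edist q.2 x₀ ^ 2 ∂π
      ≤ ∫⁻ q, (2 * edist q.1 q.2 ^ 2 + 2 * edist q.1 x₀ ^ 2) ∂π := by
        refine lintegral_mono fun q => le_trans ?_ (ENNReal.add_sq_le _ _)
        rw [edist_comm q.1 q.2]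
        gcongr
        exact edist_triangle _ _ _
    _ = 2 * ∫⁻ q, edist q.1 q.2 ^ 2 ∂π + 2 * ∫⁻ q, edist q.1 x₀ ^ 2 ∂π := by
        rw [lintegral_add_left (by fun_prop), lintegral_const_mul' _ _ (by simp),
          lintegral_const_mul' _ _ (by simp)]
    _ < ⊤ := by finiteness

/-- Transport costs pass to the limit along weakly converging marginals. -/
theorem W2_le_of_tendsto [CompleteSpace X] {μs νs : ℕ → ProbabilityMeasure X}
    {μ ν : ProbabilityMeasure X} (hμ : Tendsto μs atTop (𝓝 μ)) (hν : Tendsto νs atTop (𝓝 ν))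
    {π : ℕ → Measure (X × X)} (hπ : ∀ n, π n ∈ couplings (μs n : Measure X) (νs n))
    {c : ℕ → ℝ≥0∞} {C : ℝ≥0∞} (hc : Tendsto c atTop (𝓝 C))
    (hle : ∀ n, ∫⁻ q, edist q.1 q.2 ^ 2 ∂(π n) ≤ c n) :
    W2 (μ : Measure X) ν ≤ C ^ (1 / 2 : ℝ) := by
  have hprob := fun n => isProbabilityMeasure_of_mem_couplings (hπ n)
  let Q : ℕ → ProbabilityMeasure (X × X) := fun n => ⟨π n, hprob n⟩
  -- A convergent sequence together with its limit is compact, hence tight by completeness and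
  -- separability. Tight marginals make the plans tight.
  have tight : ∀ {ρs : ℕ → ProbabilityMeasure X} {ρ : ProbabilityMeasure X},
      Tendsto ρs atTop (𝓝 ρ) →
        IsTightMeasureSet {x | ∃ σ ∈ range ρs, (σ : Measure X) = x} := by
    intro ρs ρ h
    refine isTightMeasureSet_of_isCompact_closure ?_
    exact h.isCompact_insert_range.closure_of_subset (subset_insert _ _)
  have htight : IsTightMeasureSet {x | ∃ σ ∈ range Q, (σ : Measure (X × X)) = x} := by
    refine IsTightMeasureSet.prodMk ((tight hμ).subset ?_) ((tight hν).subset ?_)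
    · rintro _ ⟨_, ⟨_, ⟨n, rfl⟩, rfl⟩, rfl⟩
      exact ⟨μs n, ⟨n, rfl⟩, (hπ n).1.symm⟩
    · rintro _ ⟨_, ⟨_, ⟨n, rfl⟩, rfl⟩, rfl⟩
      exact ⟨νs n, ⟨n, rfl⟩, (hπ n).2.symm⟩
  obtain ⟨R, -, φ, hφ, hR⟩ := (isCompact_closure_of_isTightMeasureSet htight).tendsto_subseq
    (x := Q) fun n => subset_closure ⟨n, rfl⟩
  have hfst : R.map measurable_fst.aemeasurable = μ := by
    refine tendsto_nhds_unique
      (((ProbabilityMeasure.continuous_map continuous_fst).tendsto R).comp hR) ?_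
    refine (hμ.comp hφ.tendsto_atTop).congr fun n => ?_
    exact Subtype.ext (hπ (φ n)).1.symm
  have hsnd : R.map measurable_snd.aemeasurable = ν := by
    refine tendsto_nhds_unique
      (((ProbabilityMeasure.continuous_map continuous_snd).tendsto R).comp hR) ?_
    refine (hν.comp hφ.tendsto_atTop).congr fun n => ?_
    exact Subtype.ext (hπ (φ n)).2.symm
  have hmem : (R : Measure (X × X)) ∈ couplings (μ : Measure X) ν :=
    ⟨congrArg Subtype.val hfst, congrArg Subtype.val hsnd⟩
  refine (W2_le_of_mem_couplings hmem).trans (ENNReal.rpow_le_rpow ?_ (by norm_num))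
  have hdist : ∀ q : X × X, edist q.1 q.2 ^ 2 = ENNReal.ofReal (dist q.1 q.2 ^ 2) := fun q => by
    rw [edist_dist, ENNReal.ofReal_pow dist_nonneg]
  -- Lower semicontinuity of the cost: for a nonnegative continuous integrand it follows from the
  -- portmanteau inequality on open sets.
  calc ∫⁻ q, edist q.1 q.2 ^ 2 ∂(R : Measure (X × X))
      ≤ liminf (fun n => ∫⁻ q, edist q.1 q.2 ^ 2 ∂(Q (φ n) : Measure (X × X))) atTop := by
        simp_rw [hdist]
        exact lintegral_le_liminf_lintegral_of_forall_isOpen_measure_le_liminf_measure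
          (by fun_prop) (fun q => by positivity)
          fun G hG => ProbabilityMeasure.le_liminf_measure_open_of_tendsto hR hG
    _ ≤ liminf (fun n => c (φ n)) atTop :=
        liminf_le_liminf (Eventually.of_forall fun n => hle (φ n))
    _ = C := (hc.comp hφ.tendsto_atTop).liminf_eq

end Wasserstein

/-! ### Mixtures of measures -/

section Mixture

variable {X Y : Type*} [MetricSpace X] [MeasurableSpace X] [MetricSpace Y] [MeasurableSpace Y]

/-- A nonempty set in a separable space has a countable set of points such that a point of the set
can be measurably approximated with any given precision. -/
theorem exists_measurable_index [SecondCountableTopology Y] [BorelSpace Y] {Ω : Set Y}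
    (hΩ : Ω.Nonempty) :
    ∃ e : ℕ → Y, (∀ k, e k ∈ Ω) ∧ ∀ ε : ℝ≥0∞, 0 < ε →
      ∃ i : Y → ℕ, Measurable i ∧ ∀ y ∈ Ω, edist y (e (i y)) < ε := by
  classical
  have := hΩ.to_subtype
  refine ⟨fun k => (TopologicalSpace.denseSeq Ω k : Y), fun k => Subtype.coe_prop _, fun ε hε => ?_⟩
  -- The second alternative makes `p y` satisfiable for every `y`, so that `Nat.find` is total;
  -- density rules it out on `Ω`.
  let p : Y → ℕ → Prop := fun y k => edist y (TopologicalSpace.denseSeq Ω k : Y) < ε ∨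
    ∀ j, ε ≤ edist y (TopologicalSpace.denseSeq Ω j : Y)
  have hp : ∀ y, ∃ k, p y k := by
    intro y
    by_cases h : ∀ j, ε ≤ edist y (TopologicalSpace.denseSeq Ω j : Y)
    · exact ⟨0, Or.inr h⟩
    · push Not at h
      exact h.imp fun k hk => Or.inl hk
  refine ⟨fun y => Nat.find (hp y), measurable_find hp fun k => ?_, fun y hy => ?_⟩
  · have hm : ∀ j, Measurable fun y : Y => edist y (TopologicalSpace.denseSeq Ω j : Y) :=
      fun j => measurable_id.edist measurable_const
    refine (measurableSet_lt (hm k) measurable_const).union ?_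
    have hset : {y : Y | ∀ j, ε ≤ edist y (TopologicalSpace.denseSeq Ω j : Y)}
        = ⋂ j, {y : Y | ε ≤ edist y (TopologicalSpace.denseSeq Ω j : Y)} := by
      ext y
      simp
    exact (congrArg MeasurableSet hset).mpr
      (MeasurableSet.iInter fun j => measurableSet_le measurable_const (hm j))
  · refine (Nat.find_spec (hp y)).resolve_right ?_
    push Not
    obtain ⟨_, ⟨j, rfl⟩, hz⟩ := EMetric.mem_closure_iff.1
      ((TopologicalSpace.denseRange_denseSeq Ω) ⟨y, hy⟩) ε hε
    exact ⟨j, hz⟩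

variable [SecondCountableTopology X] [BorelSpace X]

/-- If the measures `κ y` converge weakly along approximations of `y`, then so do the mixtures. -/
theorem tendsto_bind_of_ae_tendsto {Y : Type*} [MeasurableSpace Y] {κ : Kernel Y X} [IsMarkovKernel κ]
    {μ : ProbabilityMeasure Y} {s : ℕ → Y → Y} (hs : ∀ n, Measurable (s n))
    (h : ∀ᵐ y ∂(μ : Measure Y),
      Tendsto (fun n => W2 (κ (s n y)) (κ y)) atTop (𝓝 0)) :
    Tendsto (fun n => pullbackMeasure κ (μ.map (hs n).aemeasurable)) atTop
      (𝓝 (pullbackMeasure κ μ)) := by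
  -- Portmanteau reduces the claim to a liminf inequality on open sets, which passes through the
  -- mixture by Fatou.
  refine tendsto_of_forall_isOpen_le_liminf_nat' fun G hG => ?_
  have hmeas : Measurable fun y => κ y G := κ.measurable_coe hG.measurableSet
  have h1 : ∀ n, (pullbackMeasure κ (μ.map (hs n).aemeasurable) : Measure X) G
      = ∫⁻ y, κ (s n y) G ∂(μ : Measure Y) := by
    intro n
    change (((μ : Measure Y).map (s n)).bind κ) G = _
    rw [Measure.bind_apply hG.measurableSet κ.measurable.aemeasurable, lintegral_map hmeas (hs n)]
  have h2 : (pullbackMeasure κ μ : Measure X) G = ∫⁻ y, κ y G ∂(μ : Measure Y) :=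
    Measure.bind_apply hG.measurableSet κ.measurable.aemeasurable
  simp_rw [h1, h2]
  refine le_trans (lintegral_mono_ae ?_) (lintegral_liminf_le fun n => hmeas.comp (hs n))
  filter_upwards [h] with y hy
  have hw := tendsto_of_tendsto_W2 (μs := fun n => ⟨κ (s n y), inferInstance⟩)
    (μ := ⟨κ y, inferInstance⟩) hy
  exact ProbabilityMeasure.le_liminf_measure_open_of_tendsto hw hG

/-- If `κ` is `1`-Lipschitz for the Wasserstein distance on a set of full measure, then so is the
map sending a probability measure to its mixture. -/
theorem W2_bind_le [CompleteSpace X] [SecondCountableTopology Y] [BorelSpace Y] {κ : Kernel Y X}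
    [IsMarkovKernel κ] {Ω : Set Y} (hκ : ∀ y ∈ Ω, ∀ y' ∈ Ω, W2 (κ y) (κ y') ≤ edist y y')
    {μ ν : ProbabilityMeasure Y} (hμ : ∀ᵐ y ∂(μ : Measure Y), y ∈ Ω)
    (hν : ∀ᵐ y ∂(ν : Measure Y), y ∈ Ω) :
    W2 (pullbackMeasure κ μ : Measure X) (pullbackMeasure κ ν) ≤ W2 (μ : Measure Y) ν := by
  -- Rounding to the points `e k` leaves countably many pairs of fibres, so plans can be chosen
  -- pairwise and measurability is automatic. The `e k` must lie in `Ω`, where `hκ` applies.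
  obtain ⟨e, heΩ, he⟩ := exists_measurable_index hμ.exists
  have hε : ∀ n : ℕ, (0 : ℝ≥0∞) < (n + 1 : ℝ≥0∞)⁻¹ := fun n => by simp
  have hεlim : Tendsto (fun n : ℕ => (n + 1 : ℝ≥0∞)⁻¹) atTop (𝓝 0) := by
    have := (tendsto_add_atTop_iff_nat 1).2 ENNReal.tendsto_inv_nat_nhds_zero
    simpa using this
  have hε1 : ∀ n : ℕ, (n + 1 : ℝ≥0∞)⁻¹ ≤ 1 := fun n => by simp
  choose i hi hie using fun n : ℕ => he _ (hε n)
  have hs : ∀ n, Measurable fun y => e (i n y) := fun n => (measurable_from_top).comp (hi n)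
  have hlim : ∀ y ∈ Ω, Tendsto (fun n => W2 (κ (e (i n y))) (κ y)) atTop (𝓝 0) := by
    intro y hy
    refine tendsto_of_tendsto_of_tendsto_of_le_of_le tendsto_const_nhds hεlim
      (fun _ => zero_le) fun n => ?_
    refine (hκ _ (heΩ _) _ hy).trans ?_
    rw [edist_comm]
    exact (hie n y hy).le
  refine W2_le_of_forall_couplings fun π hπ => ?_
  have := isProbabilityMeasure_of_mem_couplings hπ
  rcases eq_or_ne (∫⁻ q, edist q.1 q.2 ^ 2 ∂π) ⊤ with htop | htop
  · rw [htop]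
    exact le_top
  have hW : ∀ (n : ℕ) (a : ℕ × ℕ), ∃ ρ ∈ couplings (κ (e a.1)) (κ (e a.2)),
      ∫⁻ q, edist q.1 q.2 ^ 2 ∂ρ ≤ edist (e a.1) (e a.2) ^ 2 + (n + 1 : ℝ≥0∞)⁻¹ := by
    intro n a
    have hlt : W2 (κ (e a.1)) (κ (e a.2)) ^ 2
        < edist (e a.1) (e a.2) ^ 2 + (n + 1 : ℝ≥0∞)⁻¹ :=
      (pow_le_pow_left' (hκ _ (heΩ _) _ (heΩ _)) 2).trans_lt
        (ENNReal.lt_add_right (by finiteness) (hε n).ne')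
    obtain ⟨ρ, hρ, h⟩ := exists_coupling_lt hlt
    exact ⟨ρ, hρ, h.le⟩
  choose ρ hρ hρle using hW
  let J : ℕ → Y × Y → ℕ × ℕ := fun n q => (i n q.1, i n q.2)
  have hJ : ∀ n, Measurable (J n) := fun n =>
    ((hi n).comp measurable_fst).prodMk ((hi n).comp measurable_snd)
  have hρm : ∀ n, Measurable (ρ n) := fun n => measurable_of_countable _
  have hρJ : ∀ n, Measurable fun q => ρ n (J n q) := fun n => (hρm n).comp (hJ n)
  let P : ℕ → Measure (X × X) := fun n => π.bind fun q => ρ n (J n q)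
  have hP : ∀ n, P n ∈ couplings
      (pullbackMeasure κ (μ.map (hs n).aemeasurable) : Measure X)
      (pullbackMeasure κ (ν.map (hs n).aemeasurable)) := by
    intro n
    constructor
    · ext A hA
      rw [Measure.map_apply measurable_fst hA,
        Measure.bind_apply (measurable_fst hA) (hρJ n).aemeasurable]
      change _ = (((μ : Measure Y).map _).bind κ) A
      rw [Measure.bind_apply hA κ.measurable.aemeasurable,
        lintegral_map (κ.measurable_coe hA) (hs n), ← hπ.1,
        lintegral_map (f := fun y => κ (e (i n y)) A) ((κ.measurable_coe hA).comp (hs n)) measurable_fst]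
      refine lintegral_congr fun q => ?_
      rw [← Measure.map_apply measurable_fst hA, (hρ n (J n q)).1]
    · ext A hA
      rw [Measure.map_apply measurable_snd hA,
        Measure.bind_apply (measurable_snd hA) (hρJ n).aemeasurable]
      change _ = (((ν : Measure Y).map _).bind κ) A
      rw [Measure.bind_apply hA κ.measurable.aemeasurable,
        lintegral_map (κ.measurable_coe hA) (hs n), ← hπ.2,
        lintegral_map (f := fun y => κ (e (i n y)) A) ((κ.measurable_coe hA).comp (hs n)) measurable_snd]
      refine lintegral_congr fun q => ?_
      rw [← Measure.map_apply measurable_snd hA, (hρ n (J n q)).2]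
  -- Each endpoint moves by at most `1/(n+1)`, whence the factor 2; the last summand is the defect
  -- from optimality of the chosen plans.
  let g : ℕ → Y × Y → ℝ≥0∞ := fun n q =>
    (edist q.1 q.2 + 2 * (n + 1 : ℝ≥0∞)⁻¹) ^ 2 + (n + 1 : ℝ≥0∞)⁻¹
  have hcost : ∀ n, ∫⁻ q, edist q.1 q.2 ^ 2 ∂(P n) ≤ ∫⁻ q, g n q ∂π := by
    intro n
    rw [Measure.lintegral_bind (hρJ n).aemeasurable (by fun_prop)]
    have h1 : ∀ᵐ q ∂π, q.1 ∈ Ω := by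
      rw [← hπ.1] at hμ
      exact ae_of_ae_map measurable_fst.aemeasurable hμ
    have h2 : ∀ᵐ q ∂π, q.2 ∈ Ω := by
      rw [← hπ.2] at hν
      exact ae_of_ae_map measurable_snd.aemeasurable hν
    refine lintegral_mono_ae ?_
    filter_upwards [h1, h2] with q hq1 hq2
    refine (hρle n (J n q)).trans ?_
    dsimp only [g, J]
    gcongr
    calc edist (e (i n q.1)) (e (i n q.2))
        ≤ edist (e (i n q.1)) q.1 + edist q.1 q.2 + edist q.2 (e (i n q.2)) :=
          edist_triangle4 _ _ _ _
      _ ≤ (n + 1 : ℝ≥0∞)⁻¹ + edist q.1 q.2 + (n + 1 : ℝ≥0∞)⁻¹ := by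
          gcongr
          · rw [edist_comm]
            exact (hie n _ hq1).le
          · exact (hie n _ hq2).le
      _ = edist q.1 q.2 + 2 * (n + 1 : ℝ≥0∞)⁻¹ := by ring
  have hg : Tendsto (fun n => ∫⁻ q, g n q ∂π) atTop (𝓝 (∫⁻ q, edist q.1 q.2 ^ 2 ∂π)) := by
    refine tendsto_lintegral_of_dominated_convergence
      (fun q => 2 * edist q.1 q.2 ^ 2 + 9) (fun n => ?_) (fun n => ?_) ?_ ?_
    · have := measurable_edist (α := Y)
      fun_prop
    · refine ae_of_all _ fun q => ?_
      calc g n q ≤ (edist q.1 q.2 + 2 * 1) ^ 2 + 1 := by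
            dsimp only [g]
            gcongr
            · exact hε1 n
            · exact hε1 n
        _ ≤ 2 * edist q.1 q.2 ^ 2 + 2 * (2 * 1) ^ 2 + 1 := by
            gcongr
            exact ENNReal.add_sq_le _ _
        _ = 2 * edist q.1 q.2 ^ 2 + 9 := by ring
    · rw [lintegral_add_right _ measurable_const, lintegral_const_mul' _ _ (by simp)]
      simp [ENNReal.mul_eq_top, htop]
    · refine ae_of_all _ fun q => ?_
      have h2 : Tendsto (fun n : ℕ => 2 * (n + 1 : ℝ≥0∞)⁻¹) atTop (𝓝 0) := by
        simpa using ENNReal.Tendsto.const_mul hεlim (Or.inr ENNReal.ofNat_ne_top)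
      simpa using ((ENNReal.continuous_pow 2).tendsto _ |>.comp (h2.const_add (edist q.1 q.2))).add
        hεlim
  have hle := W2_le_of_tendsto
    (tendsto_bind_of_ae_tendsto hs (hμ.mono hlim)) (tendsto_bind_of_ae_tendsto hs (hν.mono hlim))
    hP hg hcost
  calc W2 (pullbackMeasure κ μ : Measure X) (pullbackMeasure κ ν) ^ 2
      ≤ ((∫⁻ q, edist q.1 q.2 ^ 2 ∂π) ^ (1 / 2 : ℝ)) ^ 2 := by gcongr
    _ = ∫⁻ q, edist q.1 q.2 ^ 2 ∂π := by
      rw [← ENNReal.rpow_natCast, ← ENNReal.rpow_mul]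
      norm_num

end Mixture

/-! ### Disintegrations -/

namespace IsDisintegration

variable {X Y : Type*} [MeasurableSpace X] [MeasurableSpace Y] {p : X → Y} {m : Measure X}
  {κ : Kernel Y X} [IsMarkovKernel κ]

theorem ae_ae_eq (h : IsDisintegration p m κ) : ∀ᵐ y ∂(m.map p), ∀ᵐ x ∂(κ y), p x = y := by
  filter_upwards [h.fiber] with y hy
  exact hy

theorem lintegral_eq (h : IsDisintegration p m κ) {f : X → ℝ≥0∞} (hf : Measurable f) :
    ∫⁻ x, f x ∂m = ∫⁻ y, ∫⁻ x, f x ∂(κ y) ∂(m.map p) := by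
  conv_lhs => rw [← h.bind_eq]
  exact Measure.lintegral_bind κ.measurable.aemeasurable hf.aemeasurable

/-- Almost every `κ y` lives on the fibre over `y`, where the indicator of `p ⁻¹' B` is constant,
equal to that of `B` at `y`. -/
theorem setLIntegral_preimage (h : IsDisintegration p m κ) (hp : Measurable p) {f : X → ℝ≥0∞}
    (hf : Measurable f) {B : Set Y} (hB : MeasurableSet B) :
    ∫⁻ x in p ⁻¹' B, f x ∂m = ∫⁻ y in B, ∫⁻ x, f x ∂(κ y) ∂(m.map p) := by
  rw [← lintegral_indicator (hp hB), ← lintegral_indicator hB,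
    h.lintegral_eq (hf.indicator (hp hB))]
  refine lintegral_congr_ae ?_
  filter_upwards [h.ae_ae_eq] with y hy
  by_cases hyB : y ∈ B
  · rw [indicator_of_mem hyB]
    refine lintegral_congr_ae ?_
    filter_upwards [hy] with x hx
    rw [indicator_of_mem (by simpa [hx] using hyB)]
  · rw [indicator_of_notMem hyB, ← lintegral_zero (μ := κ y)]
    refine lintegral_congr_ae ?_
    filter_upwards [hy] with x hx
    rw [indicator_of_notMem (by simpa [hx] using hyB)]

/-- Disintegrations are unique almost everywhere. -/
theorem ae_eq [MeasurableSpace.CountablyGenerated X] (h : IsDisintegration p m κ)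
    (hp : Measurable p) [SigmaFinite (m.map p)] {κ' : Kernel Y X} [IsMarkovKernel κ']
    (h' : IsDisintegration p m κ') : κ =ᵐ[m.map p] κ' := by
  have key : ∀ A, MeasurableSet A → (fun y => κ y A) =ᵐ[m.map p] fun y => κ' y A := by
    intro A hA
    refine ae_eq_of_forall_setLIntegral_eq_of_sigmaFinite (κ.measurable_coe hA)
      (κ'.measurable_coe hA) fun B hB _ => ?_
    have hm : Measurable (A.indicator (1 : X → ℝ≥0∞)) := measurable_one.indicator hA
    have e := (h.setLIntegral_preimage hp hm hB).symm.trans (h'.setLIntegral_preimage hp hm hB)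
    simpa [lintegral_indicator_one hA] using e
  -- The null set in `key` depends on `A`. Equality of the composition-products removes this
  -- dependence, as the σ-algebra of `X` is countably generated; an equivalent finite measure
  -- replaces `m.map p`.
  have hfin : (m.map p).toFinite ⊗ₘ κ = (m.map p).toFinite ⊗ₘ κ' := by
    refine Measure.ext_prod fun {B A} hB hA => ?_
    rw [Measure.compProd_apply_prod hB hA, Measure.compProd_apply_prod hB hA]
    refine setLIntegral_congr_fun_ae hB ?_
    filter_upwards [(toFinite_absolutelyContinuous (m.map p)).ae_le (key A hA)] with y hy _
    exact hy
  exact (absolutelyContinuous_toFinite (m.map p)).ae_le (Kernel.ae_eq_of_compProd_eq hfin)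

/-- Concentration on fibres gives `κ y (p ⁻¹' B) = 1_B(y)`, but only for `m.map p`-almost every `y`,
hence the absolute continuity. -/
theorem map_bind (h : IsDisintegration p m κ) (hp : Measurable p) {ν : Measure Y}
    (hν : ν ≪ m.map p) : (ν.bind κ).map p = ν := by
  ext B hB
  rw [Measure.map_apply hp hB, Measure.bind_apply (hp hB) κ.measurable.aemeasurable,
    ← lintegral_indicator_one hB]
  refine lintegral_congr_ae ?_
  filter_upwards [hν.ae_le h.ae_ae_eq] with y hy
  have : κ y (p ⁻¹' B) = κ y {_x | y ∈ B} := by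
    refine measure_congr ?_
    filter_upwards [hy] with x hx
    exact congrArg (· ∈ B) hx
  rw [this]
  by_cases hyB : y ∈ B <;> simp [hyB]

theorem bind_absolutelyContinuous (h : IsDisintegration p m κ) {ν : Measure Y}
    (hν : ν ≪ m.map p) : ν.bind κ ≪ m := by
  refine Measure.AbsolutelyContinuous.mk fun A hA h0 => ?_
  rw [← h.bind_eq, Measure.bind_apply hA κ.measurable.aemeasurable,
    lintegral_eq_zero_iff (κ.measurable_coe hA)] at h0
  rw [Measure.bind_apply hA κ.measurable.aemeasurable,
    lintegral_eq_zero_iff (κ.measurable_coe hA)]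
  exact hν.ae_le h0

theorem bind_withDensity (h : IsDisintegration p m κ) (hp : Measurable p) {ρ : Y → ℝ≥0∞}
    (hρ : Measurable ρ) : ((m.map p).withDensity ρ).bind κ = m.withDensity (ρ ∘ p) := by
  ext A hA
  rw [Measure.bind_apply hA κ.measurable.aemeasurable,
    lintegral_withDensity_eq_lintegral_mul _ hρ (κ.measurable_coe hA), withDensity_apply _ hA,
    ← lintegral_indicator hA, h.lintegral_eq ((hρ.comp hp).indicator hA)]
  refine lintegral_congr_ae ?_
  filter_upwards [h.ae_ae_eq] with y hy
  have : ∫⁻ x, A.indicator (ρ ∘ p) x ∂(κ y) = ∫⁻ x, A.indicator (fun _ => ρ y) x ∂(κ y) := by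
    refine lintegral_congr_ae ?_
    filter_upwards [hy] with x hx
    simp [indicator, hx]
  rw [this, lintegral_indicator_const hA]
  rfl

/-- The projected density is the fibre average of `ρ`, to which Jensen's inequality is applied in
`entropy_map_le`. -/
theorem map_withDensity (h : IsDisintegration p m κ) (hp : Measurable p) {ρ : X → ℝ≥0∞}
    (hρ : Measurable ρ) :
    (m.withDensity ρ).map p = (m.map p).withDensity fun y => ∫⁻ x, ρ x ∂(κ y) := by
  ext B hB
  rw [Measure.map_apply hp hB, withDensity_apply _ (hp hB), withDensity_apply _ hB,
    h.setLIntegral_preimage hp hρ hB]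

end IsDisintegration

/-! ### Entropy -/

section Entropy

variable {X Y : Type*} [MeasurableSpace X] [MeasurableSpace Y] {p : X → Y} {m : Measure X}
  {κ : Kernel Y X} [IsMarkovKernel κ]

theorem absolutelyContinuous_of_entropy_ne_top {μ : Measure X} (h : entropy m μ ≠ ⊤) : μ ≪ m := by
  by_contra hn
  exact h (if_neg fun h' => hn h'.1)

/-- The entropy of the pullback of `ν` is the entropy of `ν`. -/
theorem entropy_bind (h : IsDisintegration p m κ) (hp : Measurable p) [SigmaFinite m]
    [SigmaFinite (m.map p)] {ν : Measure Y} [SigmaFinite ν] (hν : ν ≪ m.map p) :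
    entropy m (ν.bind κ) = entropy (m.map p) ν := by
  have hρ : (ν.bind κ).rnDeriv m =ᵐ[m] ν.rnDeriv (m.map p) ∘ p := by
    have hm := Measure.measurable_rnDeriv ν (m.map p)
    have e : ν.bind κ = m.withDensity (ν.rnDeriv (m.map p) ∘ p) := by
      rw [← h.bind_withDensity hp hm, Measure.withDensity_rnDeriv_eq _ _ hν]
    rw [e]
    exact Measure.rnDeriv_withDensity m (hm.comp hp)
  have key : ∀ g : ℝ → ℝ≥0∞, Measurable g →
      ∫⁻ x, g ((ν.bind κ).rnDeriv m x).toReal ∂m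
        = ∫⁻ y, g (ν.rnDeriv (m.map p) y).toReal ∂(m.map p) := by
    intro g hg
    rw [lintegral_map (by fun_prop) hp]
    refine lintegral_congr_ae ?_
    filter_upwards [hρ] with x hx
    rw [hx]
    rfl
  have k1 := key (fun r => ENNReal.ofReal (-Real.negMulLog r))
    (Real.continuous_negMulLog.neg.measurable.ennreal_ofReal)
  have k2 := key (fun r => ENNReal.ofReal (Real.negMulLog r))
    Real.continuous_negMulLog.measurable.ennreal_ofReal
  simp only [entropy, k1, k2, hν, h.bind_absolutelyContinuous hν, true_and]

/-- Jensen's inequality for `r ↦ r log r`, with the positive and negative parts separated. -/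
theorem ofReal_mul_log_lintegral_le {ρ : Measure X} [IsProbabilityMeasure ρ] {f : X → ℝ≥0∞}
    (hf : Measurable f) (hfin : ∫⁻ x, f x ∂ρ ≠ ⊤)
    (hpos : ∫⁻ x, ENNReal.ofReal (-Real.negMulLog (f x).toReal) ∂ρ ≠ ⊤) :
    ENNReal.ofReal (-Real.negMulLog (∫⁻ x, f x ∂ρ).toReal)
        + ∫⁻ x, ENNReal.ofReal (Real.negMulLog (f x).toReal) ∂ρ ≤
      ∫⁻ x, ENNReal.ofReal (-Real.negMulLog (f x).toReal) ∂ρ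
        + ENNReal.ofReal (Real.negMulLog (∫⁻ x, f x ∂ρ).toReal) := by
  set φ : ℝ → ℝ := fun r => -Real.negMulLog r with hφ
  have hφc : Continuous φ := Real.continuous_negMulLog.neg
  have hφconv : ConvexOn ℝ (Ici 0) φ := by
    have : φ = fun x => x * Real.log x := by
      funext x
      simp [hφ, Real.negMulLog]
    rw [this]
    exact Real.convexOn_mul_log
  -- From `log r ≥ 1 - 1/r` one gets `-r log r ≤ 1 - r`. Hence the negative part is always
  -- integrable against a probability measure.
  have hneg_le : ∀ r : ℝ, 0 ≤ r → Real.negMulLog r ≤ 1 := fun r hr => by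
    rcases hr.eq_or_lt with rfl | hr'
    · simp
    have h1 := Real.one_sub_inv_le_log_of_pos hr'
    have h2 : r * (1 - r⁻¹) ≤ r * Real.log r := by gcongr
    rw [mul_sub, mul_inv_cancel₀ hr'.ne'] at h2
    simp only [Real.negMulLog]
    linarith
  have hneg : ∫⁻ x, ENNReal.ofReal (Real.negMulLog (f x).toReal) ∂ρ ≠ ⊤ := by
    refine ne_top_of_le_ne_top ENNReal.one_ne_top ?_
    calc ∫⁻ x, ENNReal.ofReal (Real.negMulLog (f x).toReal) ∂ρ ≤ ∫⁻ _, 1 ∂ρ :=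
          lintegral_mono fun x => by
            simpa using ENNReal.ofReal_le_ofReal (hneg_le _ ENNReal.toReal_nonneg)
      _ = 1 := by simp
  have hf1 : Integrable (fun x => (f x).toReal) ρ :=
    integrable_toReal_of_lintegral_ne_top hf.aemeasurable hfin
  have hm : Measurable fun x => φ (f x).toReal := hφc.measurable.comp hf.ennreal_toReal
  have hint : Integrable (fun x => φ (f x).toReal) ρ := by
    refine ⟨hm.aestronglyMeasurable, ?_⟩
    have hab : ∀ x, ‖φ (f x).toReal‖ₑ = ENNReal.ofReal (-Real.negMulLog (f x).toReal)
        + ENNReal.ofReal (Real.negMulLog (f x).toReal) := fun x => by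
      rw [← ofReal_norm, Real.norm_eq_abs]
      simp only [hφ, abs_neg]
      rcases le_total 0 (Real.negMulLog (f x).toReal) with h | h
      · rw [abs_of_nonneg h, ENNReal.ofReal_of_nonpos (neg_nonpos.2 h), zero_add]
      · rw [abs_of_nonpos h, ENNReal.ofReal_of_nonpos h, add_zero]
    rw [HasFiniteIntegral, lintegral_congr hab, lintegral_add_left (hm.ennreal_ofReal)]
    exact ENNReal.add_lt_top.2 ⟨hpos.lt_top, hneg.lt_top⟩
  have hJ := hφconv.map_integral_le hφc.continuousOn isClosed_Ici
    (ae_of_all _ fun x => ENNReal.toReal_nonneg) hf1 hint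
  rw [integral_toReal hf.aemeasurable (ae_lt_top hf hfin),
    integral_eq_lintegral_pos_part_sub_lintegral_neg_part hint] at hJ
  simp only [hφ, neg_neg] at hJ
  set a := Real.negMulLog (∫⁻ x, f x ∂ρ).toReal
  lift ∫⁻ x, ENNReal.ofReal (-Real.negMulLog (f x).toReal) ∂ρ to ℝ≥0 using hpos with P
  lift ∫⁻ x, ENNReal.ofReal (Real.negMulLog (f x).toReal) ∂ρ to ℝ≥0 using hneg with N
  simp only [ENNReal.coe_toReal] at hJ
  rw [ENNReal.ofReal, ENNReal.ofReal, ← ENNReal.coe_add, ← ENNReal.coe_add, ENNReal.coe_le_coe,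
    ← NNReal.coe_le_coe]
  push_cast [Real.coe_toNNReal']
  rcases le_total 0 a with h | h
  · rw [max_eq_right (neg_nonpos.2 h), max_eq_left h]
    linarith
  · rw [max_eq_left (neg_nonneg.2 h), max_eq_right h]
    linarith

/-- The entropy does not increase under projection. -/
theorem entropy_map_le (h : IsDisintegration p m κ) (hp : Measurable p) [SigmaFinite m]
    [SigmaFinite (m.map p)] (ν : Measure X) [IsFiniteMeasure ν] :
    entropy (m.map p) (ν.map p) ≤ entropy m ν := by
  by_cases hν : ν ≪ m ∧
      ∫⁻ x, ENNReal.ofReal (-Real.negMulLog (ν.rnDeriv m x).toReal) ∂m ≠ ⊤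
  swap
  · rw [entropy, entropy, if_neg hν]
    exact le_top
  obtain ⟨hac, hfin⟩ := hν
  set ρ := ν.rnDeriv m with hρdef
  have hρ : Measurable ρ := Measure.measurable_rnDeriv ν m
  set σ : Y → ℝ≥0∞ := fun y => ∫⁻ x, ρ x ∂(κ y) with hσdef
  have hσ : Measurable σ := hρ.lintegral_kernel
  have hmap : ν.map p = (m.map p).withDensity σ := by
    rw [← h.map_withDensity hp hρ, Measure.withDensity_rnDeriv_eq _ _ hac]
  have hac' : ν.map p ≪ m.map p := hac.map hp
  have hσeq : (ν.map p).rnDeriv (m.map p) =ᵐ[m.map p] σ := by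
    rw [hmap]
    exact Measure.rnDeriv_withDensity _ hσ
  have hmp : Measurable fun r => ENNReal.ofReal (-Real.negMulLog r) :=
    Real.continuous_negMulLog.neg.measurable.ennreal_ofReal
  have hmn : Measurable fun r => ENNReal.ofReal (Real.negMulLog r) :=
    Real.continuous_negMulLog.measurable.ennreal_ofReal
  have hmpρ : Measurable fun x => ENNReal.ofReal (-Real.negMulLog (ρ x).toReal) :=
    hmp.comp hρ.ennreal_toReal
  have hmnρ : Measurable fun x => ENNReal.ofReal (Real.negMulLog (ρ x).toReal) :=
    hmn.comp hρ.ennreal_toReal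
  have e1 : ∫⁻ y, ENNReal.ofReal (-Real.negMulLog ((ν.map p).rnDeriv (m.map p) y).toReal)
      ∂(m.map p) = ∫⁻ y, ENNReal.ofReal (-Real.negMulLog (σ y).toReal) ∂(m.map p) :=
    lintegral_congr_ae (by filter_upwards [hσeq] with y hy; rw [hy])
  have e2 : ∫⁻ y, ENNReal.ofReal (Real.negMulLog ((ν.map p).rnDeriv (m.map p) y).toReal)
      ∂(m.map p) = ∫⁻ y, ENNReal.ofReal (Real.negMulLog (σ y).toReal) ∂(m.map p) :=
    lintegral_congr_ae (by filter_upwards [hσeq] with y hy; rw [hy])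
  have hJ : ∀ᵐ y ∂(m.map p), ENNReal.ofReal (-Real.negMulLog (σ y).toReal)
        + ∫⁻ x, ENNReal.ofReal (Real.negMulLog (ρ x).toReal) ∂(κ y) ≤
      ∫⁻ x, ENNReal.ofReal (-Real.negMulLog (ρ x).toReal) ∂(κ y)
        + ENNReal.ofReal (Real.negMulLog (σ y).toReal) := by
    have f1 : ∀ᵐ y ∂(m.map p), σ y < ⊤ := by
      refine ae_lt_top hσ ?_
      rw [← h.lintegral_eq hρ]
      exact Measure.lintegral_rnDeriv_lt_top ν m |>.ne
    have f2 : ∀ᵐ y ∂(m.map p),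
        ∫⁻ x, ENNReal.ofReal (-Real.negMulLog (ρ x).toReal) ∂(κ y) < ⊤ := by
      refine ae_lt_top hmpρ.lintegral_kernel ?_
      rwa [← h.lintegral_eq hmpρ]
    filter_upwards [f1, f2] with y h1 h2
    exact ofReal_mul_log_lintegral_le hρ h1.ne h2.ne
  -- Positive parts decrease on their own: where that of `σ` is nonzero, its negative part vanishes
  -- in `hJ`.
  have hP : ∫⁻ y, ENNReal.ofReal (-Real.negMulLog (σ y).toReal) ∂(m.map p) ≤
      ∫⁻ x, ENNReal.ofReal (-Real.negMulLog (ρ x).toReal) ∂m := by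
    rw [h.lintegral_eq hmpρ]
    refine lintegral_mono_ae ?_
    filter_upwards [hJ] with y hy
    rcases le_total 0 (Real.negMulLog (σ y).toReal) with h0 | h0
    · rw [ENNReal.ofReal_of_nonpos (neg_nonpos.2 h0)]
      exact zero_le
    · rw [ENNReal.ofReal_of_nonpos h0, add_zero] at hy
      exact le_self_add.trans hy
  -- Without subtractions, the fibrewise inequality integrates over `y` even though the negative
  -- parts may have infinite integral.
  have hsum : ∫⁻ y, ENNReal.ofReal (-Real.negMulLog (σ y).toReal) ∂(m.map p)
        + ∫⁻ x, ENNReal.ofReal (Real.negMulLog (ρ x).toReal) ∂m ≤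
      ∫⁻ x, ENNReal.ofReal (-Real.negMulLog (ρ x).toReal) ∂m
        + ∫⁻ y, ENNReal.ofReal (Real.negMulLog (σ y).toReal) ∂(m.map p) := by
    rw [h.lintegral_eq hmpρ, h.lintegral_eq hmnρ,
      ← lintegral_add_left
        (f := fun y => ENNReal.ofReal (-Real.negMulLog (σ y).toReal)) (hmp.comp hσ.ennreal_toReal),
      ← lintegral_add_left hmpρ.lintegral_kernel]
    exact lintegral_mono_ae hJ
  rw [entropy, entropy, e1, e2, if_pos ⟨hac', ne_top_of_le_ne_top hfin hP⟩, if_pos ⟨hac, hfin⟩]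
  generalize (∫⁻ y, ENNReal.ofReal (-Real.negMulLog (σ y).toReal) ∂(m.map p)) = P' at *
  generalize (∫⁻ y, ENNReal.ofReal (Real.negMulLog (σ y).toReal) ∂(m.map p)) = N' at *
  generalize (∫⁻ x, ENNReal.ofReal (-Real.negMulLog (ρ x).toReal) ∂m) = P at *
  generalize (∫⁻ x, ENNReal.ofReal (Real.negMulLog (ρ x).toReal) ∂m) = N at *
  have hP' := ne_top_of_le_ne_top hfin hP
  -- If `N' = ⊤` the projected entropy is `-∞`; otherwise `hsum` forces `N` to be finite and the
  -- rest is real arithmetic.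
  rcases eq_or_ne N' ⊤ with rfl | hN'
  · lift P' to ℝ≥0 using hP'
    simp
  have hN : N ≠ ⊤ :=
    ne_top_of_le_ne_top (ENNReal.add_ne_top.2 ⟨hfin, hN'⟩) (le_add_self.trans hsum)
  lift P to ℝ≥0 using hfin
  lift P' to ℝ≥0 using hP'
  lift N to ℝ≥0 using hN
  lift N' to ℝ≥0 using hN'
  have hr : (P' : ℝ) + N ≤ P + N' := by exact_mod_cast hsum
  have hr' : (P' : ℝ) - N' ≤ P - N := by linarith
  simp only [EReal.coe_nnreal_eq_coe_real]
  exact_mod_cast hr'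

end Entropy

/-! ### The quotient map -/

namespace MetricFoliation

variable {X : Type*} [MetricSpace X] (F : MetricFoliation X)

theorem lipschitzWith_proj : LipschitzWith 1 F.proj := by
  intro x x'
  rw [edist_proj_left, ENNReal.coe_one, one_mul]
  exact Metric.infEDist_le_edist_of_mem rfl

theorem continuous_proj : Continuous F.proj := F.lipschitzWith_proj.continuous

theorem measurable_proj [MeasurableSpace X] [BorelSpace X] : Measurable F.proj :=
  F.continuous_proj.measurable

instance [SecondCountableTopology X] : SecondCountableTopology F.LeafSpace := by
  have : TopologicalSpace.SeparableSpace F.LeafSpace :=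
    F.proj_surjective.denseRange.separableSpace F.continuous_proj
  exact UniformSpace.secondCountable_of_separable _

end MetricFoliation

/-! ### Pullbacks of measures -/

section Pullback

variable {X : Type*} [MetricSpace X] [MeasurableSpace X] [BorelSpace X] {m : Measure X} {F : MetricFoliation X}
  {κ : Kernel F.LeafSpace X} [IsMarkovKernel κ]

theorem map_pullbackMeasure (hκ : IsDisintegration F.proj m κ)
    {μ : ProbabilityMeasure F.LeafSpace} (hμ : (μ : Measure F.LeafSpace) ≪ m.map F.proj) :
    (pullbackMeasure κ μ : Measure X).map F.proj = μ :=
  hκ.map_bind F.measurable_proj hμ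

variable [SecondCountableTopology X]

/-- The pullback of an absolutely continuous measure has the same entropy. -/
theorem entropy_pullbackMeasure [IsLocallyFiniteMeasure m]
    (hF : F.IsMetricMeasureFoliation m) (hκ : IsDisintegration F.proj m κ) {μ : ProbabilityMeasure F.LeafSpace}
    (hμ : (μ : Measure F.LeafSpace) ≪ m.map F.proj) :
    entropy m (pullbackMeasure κ μ) = entropy (m.map F.proj) μ := by
  have := hF.1
  exact entropy_bind hκ F.measurable_proj hμ

variable [CompleteSpace X]

/-- The pullback of absolutely continuous measures is an isometric embedding. -/
theorem W2_pullbackMeasure (hF : F.IsMetricMeasureFoliation m)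
    (hκ : IsDisintegration F.proj m κ) {μ ν : ProbabilityMeasure F.LeafSpace}
    (hμ : (μ : Measure F.LeafSpace) ≪ m.map F.proj)
    (hν : (ν : Measure F.LeafSpace) ≪ m.map F.proj) :
    W2 (pullbackMeasure κ μ : Measure X) (pullbackMeasure κ ν)
      = W2 (μ : Measure F.LeafSpace) ν := by
  obtain ⟨hlf, κ', hM, hκ', Ω, -, hΩ, hiso⟩ := hF
  -- The isometry property is given for some disintegration `κ'`; almost-everywhere uniqueness
  -- transfers it to `κ` on a smaller set of full measure.
  have hΩ' : ∀ᵐ y ∂(m.map F.proj), y ∈ Ω ∧ κ y = κ' y :=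
    (show ∀ᵐ y ∂(m.map F.proj), y ∈ Ω from hΩ).and (hκ.ae_eq F.measurable_proj hκ')
  refine le_antisymm (W2_bind_le (Ω := {y | y ∈ Ω ∧ κ y = κ' y}) ?_ (hμ.ae_le hΩ')
    (hν.ae_le hΩ')) ?_
  · rintro y ⟨hy, ey⟩ y' ⟨hy', ey'⟩
    rw [ey, ey', hiso y hy y' hy']
  · have h := W2_map_le F.measurable_proj F.lipschitzWith_proj
      (pullbackMeasure κ μ : Measure X) (pullbackMeasure κ ν)
    rwa [map_pullbackMeasure hκ hμ, map_pullbackMeasure hκ hν] at h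

/-- The descending slope of the entropy is preserved by the pullback. -/
theorem entropySlope_pullbackMeasure [IsLocallyFiniteMeasure m]
    (hF : F.IsMetricMeasureFoliation m) (hκ : IsDisintegration F.proj m κ) {μ : ProbabilityMeasure F.LeafSpace}
    (hμ : entropy (m.map F.proj) μ ≠ ⊤) :
    entropySlope m (pullbackMeasure κ μ) = entropySlope (m.map F.proj) μ := by
  have hlf := hF.1
  have hac := absolutelyContinuous_of_entropy_ne_top hμ
  have hent := entropy_pullbackMeasure hF hκ hac
  rw [entropySlope, entropySlope, if_neg hμ, if_neg (by rwa [hent]), hent]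
  refine iInf_congr fun δ => iInf_congr fun _ => le_antisymm ?_ ?_
  · refine iSup_le fun ν => iSup_le fun _ => iSup_le fun hlt => ?_
    let ν' : ProbabilityMeasure F.LeafSpace := ν.map F.measurable_proj.aemeasurable
    have hle : entropy (m.map F.proj) ν' ≤ entropy m ν :=
      entropy_map_le hκ F.measurable_proj (ν : Measure X)
    -- The projection of `ν` may be `μ` itself, which is not an admissible competitor; then `ν` has
    -- at least the entropy of the pullback and contributes 0.
    rcases eq_or_ne ν' μ with heq | hne'
    · rw [EReal.toENNReal_of_nonpos (EReal.sub_nonpos.2 (heq ▸ hle)), ENNReal.zero_div]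
      exact zero_le
    · have h1 := W2_map_le F.measurable_proj F.lipschitzWith_proj (ν : Measure X)
        (pullbackMeasure κ μ)
      have h2 := W2_map_le F.measurable_proj F.lipschitzWith_proj
        (pullbackMeasure κ μ : Measure X) ν
      rw [map_pullbackMeasure hκ hac] at h1 h2
      refine le_iSup_of_le ν' (le_iSup_of_le hne' (le_iSup_of_le (h1.trans_lt hlt) ?_))
      exact ENNReal.div_le_div (EReal.toENNReal_le_toENNReal (EReal.sub_le_sub le_rfl hle)) h2
  · refine iSup_le fun ν => iSup_le fun hne => iSup_le fun hlt => ?_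
    -- A competitor of infinite entropy contributes 0. Any other is absolutely continuous, so the
    -- isometry and entropy identities apply to its pullback.
    rcases eq_or_ne (entropy (m.map F.proj) ν) ⊤ with htop | hfin
    · rw [EReal.toENNReal_of_nonpos (EReal.sub_nonpos.2 (htop ▸ le_top)), ENNReal.zero_div]
      exact zero_le
    · have hac' := absolutelyContinuous_of_entropy_ne_top hfin
      have hne' : pullbackMeasure κ ν ≠ pullbackMeasure κ μ := fun h => hne <| Subtype.ext <| by
        change (ν : Measure F.LeafSpace) = μ
        rw [← map_pullbackMeasure hκ hac', h, map_pullbackMeasure hκ hac]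
      refine le_iSup_of_le (pullbackMeasure κ ν) (le_iSup_of_le hne' (le_iSup_of_le ?_ ?_))
      · rwa [W2_pullbackMeasure hF hκ hac' hac]
      · rw [W2_pullbackMeasure hF hκ hac hac', entropy_pullbackMeasure hF hκ hac']

end Pullback

theorem mainTheorem11 {X : Type*} [MetricSpace X] [CompleteSpace X] [SecondCountableTopology X]
    [MeasurableSpace X] [BorelSpace X] (m : Measure X) [IsLocallyFiniteMeasure m]
    [m.IsOpenPosMeasure] (K : ℝ) (hCD : CDInfinity K m)
    (F : MetricFoliation X) (hF : F.IsMetricMeasureFoliation m)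
    (hVG : VolumeGrowth (m.map F.proj))
    (κ : Kernel F.LeafSpace X) [IsMarkovKernel κ] (hκ : IsDisintegration F.proj m κ)
    (μ₀ : ProbabilityMeasure F.LeafSpace) (μ : ℝ≥0 → ProbabilityMeasure F.LeafSpace)
    (hμ : IsHeatFlow (m.map F.proj) μ₀ μ) :
    IsEDEFlow m (pullbackMeasure κ μ₀) (fun t => pullbackMeasure κ (μ t)) ∧
      (FiniteSecondMoment (pullbackMeasure κ μ₀ : Measure X) →
        IsHeatFlow m (pullbackMeasure κ μ₀) (fun t => pullbackMeasure κ (μ t))) := by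
  have hac : ∀ t, (μ t : Measure F.LeafSpace) ≪ m.map F.proj := fun t =>
    absolutelyContinuous_of_entropy_ne_top (hμ.entropy_lt_top t).ne
  have hW : ∀ s t, W2 (pullbackMeasure κ (μ s) : Measure X) (pullbackMeasure κ (μ t))
      = W2 (μ s : Measure F.LeafSpace) (μ t) := fun s t =>
    W2_pullbackMeasure hF hκ (hac s) (hac t)
  have hE : ∀ t, entropy m (pullbackMeasure κ (μ t)) = entropy (m.map F.proj) (μ t) := fun t =>
    entropy_pullbackMeasure hF hκ (hac t)
  have hS : ∀ t, entropySlope m (pullbackMeasure κ (μ t)) = entropySlope (m.map F.proj) (μ t) :=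
    fun t => entropySlope_pullbackMeasure hF hκ (hμ.entropy_lt_top t).ne
  have hflow : IsEDEFlow m (pullbackMeasure κ μ₀) (fun t => pullbackMeasure κ (μ t)) := by
    refine ⟨by rw [hμ.initial], fun t => (hE t).trans_lt (hμ.entropy_lt_top t), ?_, ?_⟩
    · obtain ⟨f, hf, hle⟩ := hμ.locallyAC
      exact ⟨f, hf, fun s t hst => (hW s t).trans_le (hle s t hst)⟩
    · intro s t hst
      have hd : ∀ r, metricDerivW2 (fun t => pullbackMeasure κ (μ t)) r = metricDerivW2 μ r :=
        fun r => by simp only [metricDerivW2, hW]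
      simp only [hE, hS, hd]
      exact hμ.ede s t hst
  refine ⟨hflow, fun h0 => ⟨hflow, fun t => ?_⟩⟩
  -- The bound in `IsLocallyACCurve` is for strictly ordered times, so `t = 0` is treated apart.
  rcases eq_or_ne t 0 with rfl | ht
  · rwa [hμ.initial]
  · refine finiteSecondMoment_of_W2_ne_top ?_ h0
    obtain ⟨f, -, hle⟩ := hflow.locallyAC
    rw [← hflow.initial]
    exact ne_top_of_le_ne_top ENNReal.ofReal_ne_top (hle 0 t (pos_iff_ne_zero.2 ht))
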